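/- There are functions $C, C' : \mathbb{N}\times\mathbb{N}\to(0,\infty)$ such that the following holds for all $n, d\in\mathbb{N}$. Let $U$ be a Haar-random $n\times n$ unitary matrix, that is, a random element of the unitary group $\mathrm{U}(n)$ distributed according to the Haar probability measure. Let $F$ be a polynomial with complex coefficients, of total degree at most $d$, in the $2n^2$ entries of $U$ and of its conjugate transpose $U^\dagger$, and regard $F = F(U,U^\dagger)$ as a complex random variable. Let $$\mathrm{Var}[F] = \mathbb{E}\big[|F|^2\big] - \big|\mathbb{E}[F]\big|^2$$ be its complex variance, and assume that $\mathrm{Var}[F]\neq 0$ (equivalently, that $F$ is not constant as a function on $\mathrm{U}(n)$). Then for every real $\varepsilon>0$ and every $z\in\mathbb{C}$, $$\Pr\big[\,|F-z|^2\le \varepsilon\,\mathrm{Var}[F]\,\big]\le C'(n,d)\,\varepsilon^{C(n,d)}.$$ -/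

import Mathlib

open MeasureTheory

/-- The unitary group `U(n)` is compact: it is closed in the space of matrices and its entries are
bounded by `1`. -/
instance unitaryGroupCompactSpace (n : ℕ) : CompactSpace (Matrix.unitaryGroup (Fin n) ℂ) := by
  refine (isCompact_iff_compactSpace
    (s := (Matrix.unitaryGroup (Fin n) ℂ : Set (Matrix (Fin n) (Fin n) ℂ)))).mp ?_
  have hK : IsCompact (Set.pi Set.univ fun _ : Fin n => Set.pi Set.univ fun _ : Fin n =>
      Metric.closedBall (0 : ℂ) 1) :=
    isCompact_univ_pi fun _ => isCompact_univ_pi fun _ => isCompact_closedBall _ _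
  refine hK.of_isClosed_subset (isClosed_unitary (R := Matrix (Fin n) (Fin n) ℂ)) ?_
  intro U hU i _ j _
  simpa using entry_norm_bound_of_unitary hU i j

/-- The Borel sigma-algebra of `U(n)`. -/
noncomputable instance unitaryGroupMeasurableSpace (n : ℕ) :
    MeasurableSpace (Matrix.unitaryGroup (Fin n) ℂ) := borel _

instance unitaryGroupBorelSpace (n : ℕ) : BorelSpace (Matrix.unitaryGroup (Fin n) ℂ) := ⟨rfl⟩

/-- The Haar measure on `U(n)`, normalised to total mass `1`. -/
noncomputable def haarUnitary (n : ℕ) : Measure (Matrix.unitaryGroup (Fin n) ℂ) :=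
  Measure.haarMeasure ⊤

/-- Complex polynomials in `2 n ^ 2` variables: `Sum.inl (i, j)` stands for the entry `U i j` and
`Sum.inr (i, j)` for the entry `Uᴴ i j`. -/
abbrev EntryPolynomial (n : ℕ) : Type :=
  MvPolynomial ((Fin n × Fin n) ⊕ (Fin n × Fin n)) ℂ

/-- The value `F(U, U†)` of a polynomial in the entries of `U` and of its conjugate transpose. -/
noncomputable def evalEntries {n : ℕ} (F : EntryPolynomial n)
    (U : Matrix.unitaryGroup (Fin n) ℂ) : ℂ :=
  MvPolynomial.eval
    (Sum.elim (fun p => (U : Matrix (Fin n) (Fin n) ℂ) p.1 p.2)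
      (fun p => (U : Matrix (Fin n) (Fin n) ℂ).conjTranspose p.1 p.2)) F

/-- The complex variance `E|X|² - |E X|²`. -/
noncomputable def complexVar {Ω : Type*} [MeasurableSpace Ω] (P : Measure Ω) (X : Ω → ℂ) : ℝ :=
  (∫ ω, ‖X ω‖ ^ 2 ∂P) - ‖∫ ω, X ω ∂P‖ ^ 2

/-!
The estimate holds with the second moment of `F - z` in place of the variance, which is at most that
second moment (`integral_norm_sub_sq_eq_complexVar_add`). So let `f` be a nonzero polynomial function
of degree at most `d` on `U(n)`, and `U` Haar-random.

On the unit circle a complex polynomial `q` of degree at most `N` satisfies a small-ball estimate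
uniformly in `q`: if `z` keeps distance at least `η (1 + ‖r‖)` from each root `r`, then
`‖q z‖ ≥ η ^ N ‖q w‖` for all `w` on the circle, and a random point `z` of a quarter circle, suitably
distributed, fails this with probability `O(N η)` (`arcMeasure_eval_lt_le`).

A unitary `V` is `W diag(u) W*`, a product of `n` elements of circle subgroups along which `f`, up to
a factor of modulus one, is a polynomial of degree at most `2d`. Averaging over translates along such
a circle and chaining the `n` factors, both by invariance of the Haar measure, shows that
`‖f U‖ < η ^ (2dn) ‖f (U V)‖` has probability `O(d n η)`, uniformly in `V` (`haarUnitary_lt_mul_le`).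
Averaging over a Haar-random `V` replaces `f (U V)` by an independent copy of `f U`
(`measure_mul_measure_le`).

It remains to see that this copy is comparable to the `L²` norm of `f` with probability bounded
below. The functions of degree at most `d` form a finite-dimensional space, on which the supremum norm
is at most a constant times the `L²` norm (`exists_sq_norm_evalEntries_le`), so this is a
Paley–Zygmund bound (`integral_sq_le_real_measure`).
-/

/-! ### Polynomials on the unit circle -/

/-- The point `√(1 - t²) + i t` of the unit circle, for `t ∈ [-1, 1]`: the circle parametrised by its
imaginary part. (It is `i` for `t > 1` and `-i` for `t < -1`.) -/
noncomputable def arc (t : ℝ) : Circle := Circle.exp (Real.arcsin t)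

lemma continuous_arc : Continuous arc :=
  Circle.exp.continuous.comp Real.continuous_arcsin

lemma arc_im {t : ℝ} (ht : t ∈ Set.Icc (0 : ℝ) 1) : (arc t : ℂ).im = t := by
  rw [arc, Circle.coe_exp, Complex.exp_ofReal_mul_I_im, Real.sin_arcsin (by linarith [ht.1]) ht.2]

/-- The uniform probability measure on the parameters `t ∈ [0, 1]` of `arc`. -/
noncomputable def arcMeasure : Measure ℝ := volume.restrict (Set.Icc (0 : ℝ) 1)

instance : IsProbabilityMeasure arcMeasure := ⟨by simp [arcMeasure]⟩

/-- The projection to the imaginary part is a contraction and is uniformly distributed along the arc,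
so a disc of radius `ρ` has probability at most `2ρ`; for `η ≤ 1 / 2` the disc in question meets the
unit circle only if `‖r‖ ≤ 3`, so that its radius is at most `4η`. -/
lemma arcMeasure_near_le (r : ℂ) {η : ℝ} (hη : 0 < η) :
    arcMeasure {t | ‖(arc t : ℂ) - r‖ < η * (1 + ‖r‖)} ≤ ENNReal.ofReal (8 * η) := by
  rcases lt_or_ge (1 / 2) η with h | h
  · refine prob_le_one.trans ?_
    rw [← ENNReal.ofReal_one]
    exact ENNReal.ofReal_le_ofReal (by linarith)
  · have hsub : {t | ‖(arc t : ℂ) - r‖ < η * (1 + ‖r‖)} ∩ Set.Icc (0 : ℝ) 1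
        ⊆ Metric.ball r.im (4 * η) := by
      rintro t ⟨ht, ht01⟩
      have ht' : ‖(arc t : ℂ) - r‖ < η * (1 + ‖r‖) := ht
      have h1 : ‖r‖ - 1 ≤ ‖(arc t : ℂ) - r‖ := by
        have := norm_sub_norm_le r (arc t : ℂ)
        rwa [Circle.norm_coe, norm_sub_rev] at this
      have h2 : |t - r.im| ≤ ‖(arc t : ℂ) - r‖ := by
        simpa [arc_im ht01] using Complex.abs_im_le_norm ((arc t : ℂ) - r)
      have h3 : ‖r‖ ≤ 3 := by nlinarith [norm_nonneg r]
      rw [Metric.mem_ball, Real.dist_eq]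
      nlinarith
    have hm : MeasurableSet (Set.Icc (0 : ℝ) 1) := measurableSet_Icc
    rw [arcMeasure, Measure.restrict_apply' hm]
    refine (measure_mono hsub).trans ?_
    rw [Real.volume_ball]
    exact ENNReal.ofReal_le_ofReal (by linarith)

/-- A point `z` that stays relatively far from all roots of `q` has a value comparable to the value at
any point `w` of the unit circle, since `‖w - r‖ ≤ 1 + ‖r‖` for each root `r`. -/
lemma Polynomial.pow_mul_norm_eval_le {q : Polynomial ℂ} {N : ℕ} (hq : q.natDegree ≤ N)
    {z w : ℂ} (hw : ‖w‖ = 1) {η : ℝ} (hη : 0 ≤ η) (hη1 : η ≤ 1)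
    (h : ∀ r ∈ q.roots, η * (1 + ‖r‖) ≤ ‖z - r‖) :
    η ^ N * ‖q.eval w‖ ≤ ‖q.eval z‖ := by
  have key : ∀ s : Multiset ℂ, (∀ r ∈ s, η * (1 + ‖r‖) ≤ ‖z - r‖) →
      η ^ s.card * ‖(s.map (w - ·)).prod‖ ≤ ‖(s.map (z - ·)).prod‖ := by
    intro s
    induction s using Multiset.induction with
    | empty => simp
    | cons a s ih =>
      intro hs
      simp only [Multiset.card_cons, Multiset.map_cons, Multiset.prod_cons, norm_mul, pow_succ]
      have h1 := ih fun r hr => hs r (Multiset.mem_cons_of_mem hr)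
      have h2 := hs a (Multiset.mem_cons_self a s)
      have h3 : ‖w - a‖ ≤ 1 + ‖a‖ := hw ▸ norm_sub_le w a
      calc η ^ s.card * η * (‖w - a‖ * ‖(s.map (w - ·)).prod‖)
          = (η * ‖w - a‖) * (η ^ s.card * ‖(s.map (w - ·)).prod‖) := by ring
        _ ≤ ‖z - a‖ * ‖(s.map (z - ·)).prod‖ := by
            refine mul_le_mul ?_ h1 (by positivity) (norm_nonneg _)
            exact (mul_le_mul_of_nonneg_left h3 hη).trans h2
  have hsp := IsAlgClosed.splits q
  rw [hsp.eval_eq_prod_roots, hsp.eval_eq_prod_roots, norm_mul, norm_mul]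
  have hc : q.roots.card ≤ N := (Polynomial.card_roots' q).trans hq
  calc η ^ N * (‖q.leadingCoeff‖ * ‖(q.roots.map (w - ·)).prod‖)
      ≤ η ^ q.roots.card * (‖q.leadingCoeff‖ * ‖(q.roots.map (w - ·)).prod‖) := by
        gcongr ?_ * _
        exact pow_le_pow_of_le_one hη hη1 hc
    _ = ‖q.leadingCoeff‖ * (η ^ q.roots.card * ‖(q.roots.map (w - ·)).prod‖) := by ring
    _ ≤ _ := by gcongr; exact key _ h

/-- Small-ball estimate for a polynomial on the unit circle. The strict inequality makes the event
empty when `q = 0`. -/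
lemma arcMeasure_eval_lt_le {q : Polynomial ℂ} {N : ℕ} (hq : q.natDegree ≤ N) (w : Circle)
    {η : ℝ} (hη : 0 < η) (hη1 : η ≤ 1) :
    arcMeasure {t | ‖q.eval (arc t : ℂ)‖ < η ^ N * ‖q.eval ((arc t * w : Circle) : ℂ)‖}
      ≤ N * ENNReal.ofReal (8 * η) := by
  have hsub : {t | ‖q.eval (arc t : ℂ)‖ < η ^ N * ‖q.eval ((arc t * w : Circle) : ℂ)‖} ⊆
      ⋃ r ∈ q.roots.toFinset, {t | ‖(arc t : ℂ) - r‖ < η * (1 + ‖r‖)} := by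
    intro t ht
    by_contra hcon
    simp only [Set.mem_iUnion, Set.mem_ofPred_eq, Multiset.mem_toFinset, not_exists,
      not_lt] at hcon
    exact absurd (Polynomial.pow_mul_norm_eval_le hq (Circle.norm_coe _) hη.le hη1 hcon)
      (not_le.mpr ht)
  calc _ ≤ _ := measure_mono hsub
    _ ≤ ∑ r ∈ q.roots.toFinset, arcMeasure {t | ‖(arc t : ℂ) - r‖ < η * (1 + ‖r‖)} :=
        measure_biUnion_finset_le _ _
    _ ≤ ∑ r ∈ q.roots.toFinset, ENNReal.ofReal (8 * η) :=
        Finset.sum_le_sum fun r _ => arcMeasure_near_le r hη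
    _ ≤ _ := by
        rw [Finset.sum_const, nsmul_eq_mul]
        gcongr
        exact (Multiset.toFinset_card_le _).trans ((Polynomial.card_roots' q).trans hq)

/-- If the variables are functions `x i` on the circle with Fourier modes in `{-1, 0, 1}`, then a
polynomial of total degree at most `d` in them has Fourier modes in `{-d, …, d}`. -/
lemma MvPolynomial.exists_circle_polynomial {σ : Type*} (F : MvPolynomial σ ℂ) {d : ℕ}
    (hF : F.totalDegree ≤ d) (x : σ → Circle → ℂ)
    (hx : ∀ i, ∃ p : Polynomial ℂ, p.natDegree ≤ 2 ∧ ∀ z : Circle, z * x i z = p.eval (z : ℂ)) :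
    ∃ q : Polynomial ℂ, q.natDegree ≤ 2 * d ∧
      ∀ z : Circle, (z : ℂ) ^ d * MvPolynomial.eval (fun i => x i z) F = q.eval (z : ℂ) := by
  choose p hp hpx using hx
  refine ⟨∑ m ∈ F.support, Polynomial.C (F.coeff m) *
    (Polynomial.X ^ (d - m.degree) * ∏ i ∈ m.support, p i ^ m i), ?_, ?_⟩
  · refine Polynomial.natDegree_sum_le_of_forall_le _ _ fun m hm => ?_
    have hmd : m.degree ≤ d := (MvPolynomial.le_totalDegree hm).trans hF
    refine (Polynomial.natDegree_C_mul_le _ _).trans ?_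
    refine Polynomial.natDegree_mul_le.trans ?_
    have h1 : (∏ i ∈ m.support, p i ^ m i).natDegree ≤ 2 * m.degree := by
      refine (Polynomial.natDegree_prod_le _ _).trans ?_
      rw [Finsupp.degree_apply, Finset.mul_sum]
      refine Finset.sum_le_sum fun i _ => ?_
      refine Polynomial.natDegree_pow_le.trans ?_
      rw [mul_comm]
      exact Nat.mul_le_mul_right _ (hp i)
    rw [Polynomial.natDegree_X_pow]
    omega
  · intro z
    rw [MvPolynomial.eval_eq, Finset.mul_sum, Polynomial.eval_finsetSum]
    refine Finset.sum_congr rfl fun m hm => ?_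
    have hmd : m.degree ≤ d := (MvPolynomial.le_totalDegree hm).trans hF
    simp only [Polynomial.eval_mul, Polynomial.eval_C, Polynomial.eval_pow, Polynomial.eval_X,
      Polynomial.eval_prod, ← hpx, mul_pow, Finset.prod_mul_distrib, Finset.prod_pow_eq_pow_sum]
    rw [← Finsupp.degree_apply, ← Nat.sub_add_cancel hmd, pow_add, Nat.add_sub_cancel]
    ring

/-! ### Diagonalisation of unitary matrices -/

namespace Matrix

variable {n : ℕ}

/-- The diagonal unitary matrix with prescribed diagonal entries, as a group homomorphism from the
torus. -/
def diagonalUnitary : (Fin n → Circle) →* unitaryGroup (Fin n) ℂ where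
  toFun u := ⟨diagonal fun i => (u i : ℂ), by
    rw [mem_unitaryGroup_iff, star_eq_conjTranspose, diagonal_conjTranspose, diagonal_mul_diagonal,
      ← diagonal_one]
    congr 1
    funext i
    simp [← Circle.coe_inv_eq_conj]⟩
  map_one' := by ext; simp [Matrix.one_apply, diagonal_apply]
  map_mul' u v := by ext; simp [Matrix.diagonal_mul_diagonal]

lemma exists_circle_det_ne_zero (V : Matrix (Fin n) (Fin n) ℂ) :
    ∃ t : Circle, (scalar (Fin n) (t : ℂ) - V).det ≠ 0 := by
  by_contra! h
  have hfin : {t | V.charpoly.IsRoot t}.Finite :=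
    Polynomial.finite_setOfPred_isRoot V.charpoly_monic.ne_zero
  refine Set.Icc_infinite (zero_lt_one (α := ℝ)) ((hfin.image Complex.im).subset fun t ht => ?_)
  exact ⟨arc t, by rw [Set.mem_ofPred_eq, Polynomial.IsRoot, eval_charpoly, h], arc_im ht⟩

/-- Every unitary matrix is unitarily diagonalisable. The proof applies the spectral theorem for
Hermitian matrices to a Cayley transform `i (t + V) (t - V)⁻¹`, where `t` is a point of the unit circle
that is not an eigenvalue of `V`. -/
theorem exists_eq_conj_diagonalUnitary (V : unitaryGroup (Fin n) ℂ) :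
    ∃ (W : unitaryGroup (Fin n) ℂ) (u : Fin n → Circle), V = W * diagonalUnitary u * W⁻¹ := by
  obtain ⟨t, ht⟩ := exists_circle_det_ne_zero (V : Matrix (Fin n) (Fin n) ℂ)
  set M : Matrix (Fin n) (Fin n) ℂ := (V : Matrix (Fin n) (Fin n) ℂ) with hM
  have hVV : Mᴴ * M = 1 := mem_unitaryGroup_iff'.mp V.2
  have htt : (starRingEnd ℂ) (t : ℂ) * t = 1 := by
    rw [← Circle.coe_inv_eq_conj]; simp
  set A := scalar (Fin n) (t : ℂ) - M with hA
  set B := scalar (Fin n) (t : ℂ) + M with hB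
  have hu : IsUnit A.det := isUnit_iff_ne_zero.mpr ht
  have hsc : ∀ c : ℂ, scalar (Fin n) c = c • (1 : Matrix (Fin n) (Fin n) ℂ) := fun c => by
    rw [scalar_apply, smul_one_eq_diagonal]
  -- Unitarity of `V` enters here: it makes `B A⁻¹` skew-Hermitian.
  have hAB : Bᴴ * A = -(Aᴴ * B) := by
    simp only [hA, hB, hsc, conjTranspose_add, conjTranspose_sub, conjTranspose_smul,
      conjTranspose_one, add_mul, sub_mul, mul_add, mul_sub, hVV, smul_mul_assoc, mul_smul_comm,
      one_mul, mul_one, smul_add, smul_sub, smul_smul]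
    simp only [RCLike.star_def, htt, mul_comm (t : ℂ), one_smul]
    abel
  set H := Complex.I • (B * A⁻¹) with hH
  have hHA : H * A = Complex.I • B := by
    rw [hH, smul_mul_assoc, mul_assoc, nonsing_inv_mul _ hu, mul_one]
  have hHherm : H.IsHermitian := by
    have hu' : IsUnit Aᴴ.det := by rw [det_conjTranspose]; exact hu.star
    have h1 : Aᴴ * Hᴴ = Aᴴ * H := by
      rw [hH, conjTranspose_smul, conjTranspose_mul, mul_smul_comm, mul_smul_comm, ← mul_assoc,
        ← conjTranspose_mul, nonsing_inv_mul _ hu, conjTranspose_one, one_mul, ← mul_assoc,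
        ← neg_eq_iff_eq_neg.mpr hAB, neg_mul, mul_assoc, mul_nonsing_inv _ hu, mul_one]
      simp
    have h2 := congrArg (fun X => (Aᴴ)⁻¹ * X) h1
    rw [IsHermitian]
    simpa only [← mul_assoc, nonsing_inv_mul _ hu', one_mul] using h2
  set W := hHherm.eigenvectorUnitary with hW
  set l := hHherm.eigenvalues with hl
  have hspec : H = (W : Matrix (Fin n) (Fin n) ℂ) * diagonal (fun i => (l i : ℂ)) *
      (W : Matrix (Fin n) (Fin n) ℂ)ᴴ := by
    have := hHherm.spectral_theorem
    rw [Unitary.conjStarAlgAut_apply] at this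
    exact this
  have hne : ∀ i, (l i : ℂ) + Complex.I ≠ 0 := fun i h => by
    have := congrArg Complex.im h
    simp at this
  have hnorm : ∀ i, ‖((l i : ℂ) - Complex.I) / ((l i : ℂ) + Complex.I)‖ = 1 := fun i => by
    rw [norm_div, div_eq_one_iff_eq (norm_ne_zero_iff.mpr (hne i)), ← Complex.norm_conj]
    simp [sub_eq_add_neg]
  have hWW : (W : Matrix (Fin n) (Fin n) ℂ)ᴴ * W = 1 := mem_unitaryGroup_iff'.mp W.2
  have hWW' : (W : Matrix (Fin n) (Fin n) ℂ) * (W : Matrix (Fin n) (Fin n) ℂ)ᴴ = 1 :=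
    mem_unitaryGroup_iff.mp W.2
  let u : Fin n → Circle := fun i =>
    t * ⟨((l i : ℂ) - Complex.I) / ((l i : ℂ) + Complex.I), mem_sphere_zero_iff_norm.mpr (hnorm i)⟩
  refine ⟨W, u, ?_⟩
  set X := (W : Matrix (Fin n) (Fin n) ℂ)ᴴ with hX
  -- With `H = W D W*`, the relation `H (t - V) = i (t + V)` becomes `(D + i) W* V = t (D - i) W*`.
  have h1 : diagonal (fun i => (l i : ℂ)) * X * A = Complex.I • (X * B) := by
    have := congrArg (fun Y => X * Y) hHA
    simpa only [hspec, ← mul_assoc, hWW, one_mul, mul_smul_comm] using this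
  have h2 : X * M = diagonal (fun i => (u i : ℂ)) * X := by
    ext i j
    have h3 := congrFun (congrFun h1 i) j
    simp only [hA, hB, hsc, mul_sub, mul_add, mul_smul_comm, mul_one, Matrix.sub_apply,
      Matrix.smul_apply, Matrix.add_apply, mul_assoc, diagonal_mul, smul_eq_mul] at h3 ⊢
    have h4 := hne i
    have h5 : (u i : ℂ) = t * (((l i : ℂ) - Complex.I) / ((l i : ℂ) + Complex.I)) := rfl
    rw [h5]
    field_simp
    linear_combination -h3
  apply Subtype.ext
  change M = (W : Matrix (Fin n) (Fin n) ℂ) * diagonal (fun i => (u i : ℂ)) * X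
  rw [mul_assoc, ← h2, ← mul_assoc, hWW', one_mul]

end Matrix

/-! ### Translations on a group with invariant measure -/

section Group

variable {G : Type*} [Group G] [TopologicalSpace G] [IsTopologicalGroup G]
  [MeasurableSpace G] [BorelSpace G]

lemma isMulRightInvariant_of_compactSpace [CompactSpace G] (μ : Measure G) [μ.IsHaarMeasure]
    [IsProbabilityMeasure μ] : μ.IsMulRightInvariant := by
  refine ⟨fun g => ?_⟩
  have : IsProbabilityMeasure (μ.map (· * g)) :=
    Measure.isProbabilityMeasure_map (measurable_mul_const g).aemeasurable
  exact Measure.isHaarMeasure_eq_of_isProbabilityMeasure _ _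

/-- By right invariance, `μ A` is the average over `U` of the proportion of the curve `t ↦ U * γ t`
that lies in `A`. -/
lemma measure_le_of_forall_average_le [SecondCountableTopology G] (μ : Measure G)
    [IsProbabilityMeasure μ] [μ.IsMulRightInvariant] (ν : Measure ℝ) [IsProbabilityMeasure ν]
    {γ : ℝ → G} (hγ : Continuous γ) {A : Set G} (hA : MeasurableSet A) {B : ENNReal}
    (h : ∀ U, ν {t | U * γ t ∈ A} ≤ B) : μ A ≤ B := by
  have hm : MeasurableSet {p : G × ℝ | p.1 * γ p.2 ∈ A} :=
    (continuous_fst.mul (hγ.comp continuous_snd)).measurable hA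
  have h1 : μ.prod ν {p : G × ℝ | p.1 * γ p.2 ∈ A} ≤ B := by
    rw [Measure.prod_apply hm]
    calc _ ≤ ∫⁻ _, B ∂μ := lintegral_mono fun U => h U
      _ = B := by simp
  refine le_trans (le_of_eq ?_) h1
  rw [Measure.prod_apply_symm hm]
  have : ∀ t, μ ((fun x => (x, t)) ⁻¹' {p : G × ℝ | p.1 * γ p.2 ∈ A}) = μ A := fun t =>
    measure_preimage_mul_right μ (γ t) A
  simp only [this, lintegral_const, measure_univ, mul_one]

/-- If `f U` is rarely much smaller than `f (U g)` for each `g = φ (k i)`, the same holds for a product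
of such elements: by right invariance the bad events of the successive factors are translates of the
given ones. -/
lemma measure_lt_comp_prod_le {ι : Type*} [DecidableEq ι] {K : Type*} [CommMonoid K]
    (μ : Measure G) [μ.IsMulRightInvariant] (φ : K →* G) (f : G → ℝ) {s : ℝ} (hs : 0 ≤ s)
    {B : ENNReal} (k : ι → K) (h : ∀ i, μ {U | f U < s * f (U * φ (k i))} ≤ B) (S : Finset ι) :
    μ {U | f U < s ^ S.card * f (U * φ (∏ i ∈ S, k i))} ≤ S.card * B := by
  induction S using Finset.induction with
  | empty => simp
  | insert a S ha ih =>
    have hsub : {U | f U < s ^ (insert a S).card * f (U * φ (∏ i ∈ insert a S, k i))} ⊆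
        {U | f U < s * f (U * φ (k a))} ∪
          (· * φ (k a)) ⁻¹' {U | f U < s ^ S.card * f (U * φ (∏ i ∈ S, k i))} := by
      intro U hU
      by_contra hcon
      simp only [Set.mem_union, Set.mem_ofPred_eq, Set.mem_preimage, not_or, not_lt] at hcon
      obtain ⟨h1, h2⟩ := hcon
      rw [Set.mem_ofPred_eq, Finset.card_insert_of_notMem ha, Finset.prod_insert ha, map_mul,
        ← mul_assoc, pow_succ', mul_assoc s] at hU
      exact absurd ((mul_le_mul_of_nonneg_left h2 hs).trans h1) (not_le.mpr hU)
    calc _ ≤ _ := measure_mono hsub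
      _ ≤ _ := measure_union_le _ _
      _ ≤ B + S.card * B := by
          rw [measure_preimage_mul_right]
          exact add_le_add (h a) ih
      _ = _ := by
          rw [Finset.card_insert_of_notMem ha]
          push_cast
          ring

/-- If `f U` is rarely much smaller than `f (U * V)` for each fixed `V`, then by averaging over `V` it is
rarely much smaller than `f V` for an independent `V`, since `U * V` is distributed like `V` for
fixed `U`. -/
lemma measure_mul_measure_le [SecondCountableTopology G] (μ : Measure G)
    [IsProbabilityMeasure μ] [μ.IsMulLeftInvariant] {f : G → ℝ} (hf : Continuous f) {s : ℝ}
    (hs : 0 ≤ s) {B : ENNReal} (h : ∀ V, μ {U | f U < s * f (U * V)} ≤ B) (a : ℝ) :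
    μ {U | f U < s * a} * μ {U | a ≤ f U} ≤ B := by
  have hm : MeasurableSet {p : G × G | f p.1 < s * f (p.1 * p.2)} :=
    (isOpen_lt (by fun_prop) (by fun_prop)).measurableSet
  have hm' : MeasurableSet {p : G × G | f p.1 < s * f p.2} :=
    (isOpen_lt (by fun_prop) (by fun_prop)).measurableSet
  have h1 : μ.prod μ {p : G × G | f p.1 < s * f (p.1 * p.2)} ≤ B := by
    rw [Measure.prod_apply_symm hm]
    calc _ ≤ ∫⁻ _, B ∂μ := lintegral_mono fun V => h V
      _ = B := by simp
  have h2 : μ.prod μ {p : G × G | f p.1 < s * f (p.1 * p.2)} =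
      μ.prod μ {p : G × G | f p.1 < s * f p.2} := by
    rw [Measure.prod_apply hm, Measure.prod_apply hm']
    refine lintegral_congr fun U => ?_
    exact measure_preimage_mul μ U (Prod.mk U ⁻¹' {p : G × G | f p.1 < s * f p.2})
  rw [← Measure.prod_prod]
  refine (measure_mono ?_).trans (h2.symm.le.trans h1)
  rintro ⟨U, V⟩ ⟨hU, hV⟩
  exact lt_of_lt_of_le hU (mul_le_mul_of_nonneg_left hV hs)

end Group

/-! ### Comparison of norms -/

/-- A Paley–Zygmund bound: if `f² ≤ K 𝔼[f²]` pointwise and `𝔼[f²] > 0`, then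
`f² ≥ 𝔼[f²] / 2` with probability at least `1 / (2K)`. -/
lemma integral_sq_le_real_measure {Ω : Type*} [MeasurableSpace Ω] (μ : Measure Ω)
    [IsProbabilityMeasure μ] {f : Ω → ℝ} (hf : Measurable f) {K A : ℝ}
    (hA : ∫ x, f x ^ 2 ∂μ = A) (hfK : ∀ x, f x ^ 2 ≤ K * A) (hf0 : ∀ x, 0 ≤ f x) :
    A ≤ 2 * (K * A) * μ.real {x | √(A / 2) ≤ f x} := by
  have hA0 : 0 ≤ A := hA ▸ integral_nonneg fun x => sq_nonneg (f x)
  have hm : MeasurableSet {x | √(A / 2) ≤ f x} := measurableSet_le measurable_const hf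
  have hint : Integrable ({x | √(A / 2) ≤ f x}.indicator fun _ => K * A) μ :=
    (integrable_const _).indicator hm
  have h1 : A ≤ ∫ x, (A / 2 + {x | √(A / 2) ≤ f x}.indicator (fun _ => K * A) x) ∂μ := by
    rw [← hA]
    refine integral_mono_of_nonneg (ae_of_all _ fun x => sq_nonneg (f x))
      ((integrable_const _).add (hA ▸ hint)) (ae_of_all _ fun x => ?_)
    rw [hA]
    by_cases hx : √(A / 2) ≤ f x
    · simp only [Set.indicator_of_mem (show x ∈ {x | √(A / 2) ≤ f x} from hx)]
      linarith [hfK x]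
    · simp only [Set.indicator_of_notMem (show x ∉ {x | √(A / 2) ≤ f x} from hx), add_zero]
      rw [not_le, Real.lt_sqrt (hf0 x)] at hx
      exact hx.le
  rw [integral_add (integrable_const _) hint, integral_indicator_const _ hm] at h1
  simp only [integral_const, probReal_univ, smul_eq_mul, one_mul] at h1
  linarith

/-- On a finite-dimensional space of continuous functions the supremum norm is dominated by the `L²`
norm. -/
lemma exists_sq_norm_le_integral {X : Type*} [TopologicalSpace X] [CompactSpace X]
    [MeasurableSpace X] [BorelSpace X] (μ : Measure X) [IsFiniteMeasure μ] [μ.IsOpenPosMeasure]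
    (S : Submodule ℂ C(X, ℂ)) [FiniteDimensional ℂ S] :
    ∃ K : ℝ, 1 ≤ K ∧ ∀ f ∈ S, ∀ x, ‖f x‖ ^ 2 ≤ K * ∫ y, ‖f y‖ ^ 2 ∂μ := by
  obtain ⟨T, hTf⟩ : ∃ T : S →ₗ[ℂ] Lp ℂ 2 μ, ∀ f, T f = ContinuousMap.toLp 2 μ ℂ (f : C(X, ℂ)) :=
    ⟨(ContinuousMap.toLp 2 μ ℂ : C(X, ℂ) →L[ℂ] Lp ℂ 2 μ).toLinearMap ∘ₗ S.subtype, fun _ => rfl⟩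
  have hT : T.ker = ⊥ := LinearMap.ker_eq_bot.mpr fun f g hfg => by
    rw [hTf, hTf] at hfg
    exact Subtype.ext (ContinuousMap.toLp_injective μ hfg)
  obtain ⟨K, -, hK⟩ := T.exists_antilipschitzWith hT
  have hT2 : ∀ f : S, ‖T f‖ ^ 2 = ∫ y, ‖(f : C(X, ℂ)) y‖ ^ 2 ∂μ := fun f => by
    have h := ContinuousMap.inner_toLp (𝕜 := ℂ) μ (f : C(X, ℂ)) f
    have h2 : ∀ y, (f : C(X, ℂ)) y * (starRingEnd ℂ) ((f : C(X, ℂ)) y) =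
        ((‖(f : C(X, ℂ)) y‖ ^ 2 : ℝ) : ℂ) := fun y => by
      rw [Complex.mul_conj, Complex.normSq_eq_norm_sq]
    simp only [h2] at h
    rw [inner_self_eq_norm_sq_to_K, integral_complex_ofReal, ← hTf] at h
    refine Complex.ofReal_injective ?_
    rw [Complex.ofReal_pow]
    exact h
  refine ⟨max 1 ((K : ℝ) ^ 2), le_max_left _ _, fun f hf x => ?_⟩
  have h1 : ‖f‖ ≤ K * ‖T ⟨f, hf⟩‖ := by
    exact ZeroHomClass.bound_of_antilipschitz T hK ⟨f, hf⟩
  have h2 : ‖f x‖ ≤ K * ‖T ⟨f, hf⟩‖ := (f.norm_coe_le_norm x).trans h1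
  calc ‖f x‖ ^ 2 ≤ (K * ‖T ⟨f, hf⟩‖) ^ 2 := by gcongr
    _ = (K : ℝ) ^ 2 * ∫ y, ‖f y‖ ^ 2 ∂μ := by rw [mul_pow, hT2]
    _ ≤ _ := by
        gcongr
        exact le_max_right _ _

/-! ### Polynomials on the unitary group -/

section Unitary
variable {n : ℕ}

instance : SecondCountableTopology (Matrix.unitaryGroup (Fin n) ℂ) :=
  inferInstanceAs (SecondCountableTopology
    {M : Fin n → Fin n → ℂ // M ∈ Matrix.unitaryGroup (Fin n) ℂ})

instance : (haarUnitary n).IsHaarMeasure := by unfold haarUnitary; infer_instance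

instance : IsProbabilityMeasure (haarUnitary n) := ⟨Measure.haarMeasure_self⟩

instance : (haarUnitary n).IsMulRightInvariant := isMulRightInvariant_of_compactSpace _

lemma continuous_evalEntries (F : EntryPolynomial n) : Continuous (evalEntries F) := by
  refine (MvPolynomial.continuous_eval F).comp (continuous_pi ?_)
  rintro (p | p)
  · exact (continuous_subtype_val.matrix_elem p.1 p.2)
  · exact (continuous_subtype_val.matrix_conjTranspose.matrix_elem p.1 p.2)

/-- The parametrisation `u ↦ W diag(u) W⁻¹` of the maximal torus of unitary matrices that are diagonal
in the basis given by the columns of `W`. -/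
noncomputable def torusUnitary (W : Matrix.unitaryGroup (Fin n) ℂ) :
    (Fin n → Circle) →* Matrix.unitaryGroup (Fin n) ℂ :=
  (MulAut.conj W).toMonoidHom.comp Matrix.diagonalUnitary

lemma torusUnitary_apply (W : Matrix.unitaryGroup (Fin n) ℂ) (u : Fin n → Circle) :
    torusUnitary W u = W * Matrix.diagonalUnitary u * W⁻¹ := rfl

lemma continuous_torusUnitary_mulSingle (W : Matrix.unitaryGroup (Fin n) ℂ) (j : Fin n) :
    Continuous fun z : Circle => torusUnitary W (Pi.mulSingle j z) := by
  have h : Continuous (Matrix.diagonalUnitary (n := n)) := by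
    refine Continuous.subtype_mk ?_ _
    exact Continuous.matrix_diagonal (by fun_prop)
  have h2 : Continuous fun z : Circle => (Pi.mulSingle j z : Fin n → Circle) :=
    Continuous.update continuous_const j continuous_id
  exact (continuous_const.mul (h.comp h2)).mul continuous_const

/-- Along a coordinate circle of a torus the matrix entries are affine functions of `z`. -/
lemma exists_entry_mul_torusUnitary (U W : Matrix.unitaryGroup (Fin n) ℂ) (j a b : Fin n) :
    ∃ α β : ℂ, ∀ z : Circle, ((U * torusUnitary W (Pi.mulSingle j z) :
      Matrix.unitaryGroup (Fin n) ℂ) : Matrix (Fin n) (Fin n) ℂ) a b = α + β * z := by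
  refine ⟨∑ k ∈ Finset.univ.erase j, (U * W).1 a k * (W⁻¹).1 k b, (U * W).1 a j * (W⁻¹).1 j b,
    fun z => ?_⟩
  have : U * torusUnitary W (Pi.mulSingle j z) =
      U * W * Matrix.diagonalUnitary (Pi.mulSingle j z) * W⁻¹ := by
    rw [torusUnitary_apply]; group
  rw [this]
  change (((U * W).1 * Matrix.diagonal fun i => ((Pi.mulSingle j z : Fin n → Circle) i : ℂ)) *
    (W⁻¹).1) a b = _
  rw [Matrix.mul_apply, ← Finset.sum_erase_add _ _ (Finset.mem_univ j)]
  simp only [Matrix.mul_diagonal, Pi.mulSingle_eq_same]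
  congr 1
  · refine Finset.sum_congr rfl fun k hk => ?_
    rw [Pi.mulSingle_eq_of_ne (Finset.ne_of_mem_erase hk)]
    simp
  · ring

lemma exists_polynomial_evalEntries_mul_torusUnitary {d : ℕ} (F : EntryPolynomial n)
    (hF : F.totalDegree ≤ d) (U W : Matrix.unitaryGroup (Fin n) ℂ) (j : Fin n) :
    ∃ q : Polynomial ℂ, q.natDegree ≤ 2 * d ∧ ∀ z : Circle,
      ‖evalEntries F (U * torusUnitary W (Pi.mulSingle j z))‖ = ‖q.eval (z : ℂ)‖ := by
  obtain ⟨q, hq, hqz⟩ := F.exists_circle_polynomial hF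
    (fun i z => Sum.elim
      (fun p => (U * torusUnitary W (Pi.mulSingle j z)).1 p.1 p.2)
      (fun p => (U * torusUnitary W (Pi.mulSingle j z)).1.conjTranspose p.1 p.2) i) (by
    rintro (p | p)
    · obtain ⟨α, β, h⟩ := exists_entry_mul_torusUnitary U W j p.1 p.2
      refine ⟨Polynomial.C α * Polynomial.X + Polynomial.C β * Polynomial.X ^ 2,
        by compute_degree, fun z => ?_⟩
      simp only [Sum.elim_inl, h]
      simp
      ring
    · obtain ⟨α, β, h⟩ := exists_entry_mul_torusUnitary U W j p.2 p.1
      refine ⟨Polynomial.C (star α) * Polynomial.X + Polynomial.C (star β),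
        by compute_degree!, fun z => ?_⟩
      have hz : (z : ℂ) * (starRingEnd ℂ) z = 1 := by
        rw [← Circle.coe_inv_eq_conj]; simp
      simp only [Sum.elim_inr, Matrix.conjTranspose_apply, h]
      simp only [Polynomial.eval_add, Polynomial.eval_mul, Polynomial.eval_C, Polynomial.eval_X,
        RCLike.star_def, map_add, map_mul]
      linear_combination (starRingEnd ℂ) β * hz)
  refine ⟨q, hq, fun z => ?_⟩
  rw [← hqz z, norm_mul, norm_pow, Circle.norm_coe, one_pow, one_mul]
  rfl

/-- Translation by an element of a coordinate circle of a torus: on each coset of the circle the claim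
is the small-ball estimate for a polynomial on the unit circle. -/
lemma haarUnitary_lt_mul_torusUnitary_le {d : ℕ} (F : EntryPolynomial n)
    (hF : F.totalDegree ≤ d) (W : Matrix.unitaryGroup (Fin n) ℂ) (j : Fin n) (w : Circle)
    {η : ℝ} (hη : 0 < η) (hη1 : η ≤ 1) :
    haarUnitary n {U | ‖evalEntries F U‖ <
      η ^ (2 * d) * ‖evalEntries F (U * torusUnitary W (Pi.mulSingle j w))‖}
      ≤ (2 * d : ℕ) * ENNReal.ofReal (8 * η) := by
  have hc := continuous_evalEntries F
  refine measure_le_of_forall_average_le _ arcMeasure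
    ((continuous_torusUnitary_mulSingle W j).comp continuous_arc)
    (isOpen_lt (by fun_prop) (by fun_prop)).measurableSet fun U => ?_
  obtain ⟨q, hq, hqz⟩ := exists_polynomial_evalEntries_mul_torusUnitary F hF U W j
  simpa only [Set.mem_ofPred_eq, Function.comp_apply, mul_assoc, ← map_mul, ← Pi.mulSingle_mul,
    hqz] using arcMeasure_eval_lt_le hq w hη hη1

/-- For fixed `V`, a polynomial is rarely much smaller at `U` than at `U * V`, uniformly in `V`. -/
lemma haarUnitary_lt_mul_le {d : ℕ} (F : EntryPolynomial n)
    (hF : F.totalDegree ≤ d) (V : Matrix.unitaryGroup (Fin n) ℂ)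
    {η : ℝ} (hη : 0 < η) (hη1 : η ≤ 1) :
    haarUnitary n {U | ‖evalEntries F U‖ <
      (η ^ (2 * d)) ^ n * ‖evalEntries F (U * V)‖}
      ≤ n * ((2 * d : ℕ) * ENNReal.ofReal (8 * η)) := by
  obtain ⟨W, u, rfl⟩ := Matrix.exists_eq_conj_diagonalUnitary V
  have := measure_lt_comp_prod_le (haarUnitary n) (torusUnitary W) (fun U => ‖evalEntries F U‖)
    (s := η ^ (2 * d)) (by positivity) (fun j => Pi.mulSingle j (u j))
    (fun j => haarUnitary_lt_mul_torusUnitary_le F hF W j (u j) hη hη1) Finset.univ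
  simpa only [Finset.univ_prod_mulSingle, Finset.card_univ, Fintype.card_fin,
    torusUnitary_apply] using this

/-- `evalEntries` as a linear map into the continuous functions on `U(n)`. -/
noncomputable def evalEntriesLinear (n : ℕ) :
    EntryPolynomial n →ₗ[ℂ] C(Matrix.unitaryGroup (Fin n) ℂ, ℂ) where
  toFun F := ⟨evalEntries F, continuous_evalEntries F⟩
  map_add' F G := by ext U; simp [evalEntries]
  map_smul' c F := by ext U; simp [evalEntries]

lemma exists_sq_norm_evalEntries_le (n d : ℕ) :
    ∃ K : ℝ, 1 ≤ K ∧ ∀ F : EntryPolynomial n, F.totalDegree ≤ d → ∀ U,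
      ‖evalEntries F U‖ ^ 2 ≤ K * ∫ V, ‖evalEntries F V‖ ^ 2 ∂haarUnitary n := by
  obtain ⟨K, hK1, hK⟩ := exists_sq_norm_le_integral (haarUnitary n)
    ((MvPolynomial.restrictTotalDegree _ ℂ d).map (evalEntriesLinear n))
  refine ⟨K, hK1, fun F hF U => ?_⟩
  exact hK _ (Submodule.mem_map_of_mem ((MvPolynomial.mem_restrictTotalDegree _ _ _).mpr hF)) U

/-- The small-ball estimate relative to the second moment. -/
lemma haarUnitary_sq_norm_evalEntries_le {d : ℕ} {K : ℝ} (hK1 : 1 ≤ K)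
    (hK : ∀ F : EntryPolynomial n, F.totalDegree ≤ d → ∀ U,
      ‖evalEntries F U‖ ^ 2 ≤ K * ∫ V, ‖evalEntries F V‖ ^ 2 ∂haarUnitary n)
    (F : EntryPolynomial n) (hF : F.totalDegree ≤ d)
    (hA : 0 < ∫ V, ‖evalEntries F V‖ ^ 2 ∂haarUnitary n) {ε : ℝ} (hε : 0 < ε) :
    (haarUnitary n).real {U | ‖evalEntries F U‖ ^ 2 ≤
      ε * ∫ V, ‖evalEntries F V‖ ^ 2 ∂haarUnitary n} ≤
    32 * K * ((2 * d + 1) * (n + 1) : ℕ) * ε ^ (1 / (2 * ((2 * d + 1) * (n + 1) : ℕ)) : ℝ) := by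
  set A := ∫ V, ‖evalEntries F V‖ ^ 2 ∂haarUnitary n with hAdef
  set L : ℕ := (2 * d + 1) * (n + 1) with hL
  have hL1 : (1 : ℝ) ≤ L := by exact_mod_cast Nat.one_le_iff_ne_zero.mpr (by positivity)
  -- `η` is chosen so that `(η ^ L)² = 4 ε`; then `‖F‖² ≤ ε A` forces `‖F‖ < η ^ L * √(A / 2)`.
  set η : ℝ := (4 * ε) ^ (1 / (2 * L : ℝ)) with hηdef
  have hη : 0 < η := by positivity
  have hηε : η ≤ 2 * ε ^ (1 / (2 * L : ℝ)) := by
    rw [hηdef, Real.mul_rpow (by norm_num) hε.le]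
    gcongr
    rw [show (4 : ℝ) = 2 ^ (2 : ℝ) by norm_num, ← Real.rpow_mul (by norm_num)]
    conv_rhs => rw [← Real.rpow_one 2]
    apply Real.rpow_le_rpow_of_exponent_le (by norm_num)
    rw [mul_one_div, div_le_one (by positivity)]
    linarith
  suffices h : (haarUnitary n).real {U | ‖evalEntries F U‖ ^ 2 ≤ ε * A} ≤ 16 * K * L * η by
    refine h.trans ?_
    calc 16 * K * L * η ≤ 16 * K * L * (2 * ε ^ (1 / (2 * L : ℝ))) := by gcongr
      _ = _ := by ring
  rcases lt_or_ge 1 η with h1 | h1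
  · refine measureReal_le_one.trans ?_
    have : 1 ≤ K * L * η :=
      one_le_mul_of_one_le_of_one_le (one_le_mul_of_one_le_of_one_le hK1 hL1) h1.le
    linarith
  have hsq : (η ^ L) ^ 2 = 4 * ε := by
    rw [← pow_mul, hηdef, ← Real.rpow_natCast, ← Real.rpow_mul (by positivity)]
    have : 1 / (2 * L : ℝ) * ((L * 2 : ℕ) : ℝ) = 1 := by
      push_cast; field_simp
    rw [this, Real.rpow_one]
  set s : ℝ := (η ^ (2 * d)) ^ n with hs
  have hs0 : 0 < s := by positivity
  have hsL : η ^ L ≤ s := by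
    rw [hs, ← pow_mul]
    exact pow_le_pow_of_le_one hη.le h1 (Nat.mul_le_mul (by omega) (by omega))
  have hc := continuous_evalEntries F
  have hprod := measure_mul_measure_le (haarUnitary n) (f := fun U => ‖evalEntries F U‖)
    (by fun_prop) hs0.le (fun V => haarUnitary_lt_mul_le F hF V hη h1) √(A / 2)
  have hprod' : (haarUnitary n).real {U | ‖evalEntries F U‖ < s * √(A / 2)} *
      (haarUnitary n).real {U | √(A / 2) ≤ ‖evalEntries F U‖} ≤ n * ((2 * d) * (8 * η)) := by
    have := ENNReal.toReal_mono (by finiteness) hprod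
    rw [ENNReal.toReal_mul, ENNReal.toReal_mul, ENNReal.toReal_mul,
      ENNReal.toReal_ofReal (by positivity)] at this
    simpa [Measure.real] using this
  have hlow := integral_sq_le_real_measure (haarUnitary n) (f := fun U => ‖evalEntries F U‖)
    hc.norm.measurable hAdef.symm (hK F hF) (fun _ => norm_nonneg _)
  set p := (haarUnitary n).real {U | √(A / 2) ≤ ‖evalEntries F U‖} with hp
  have hlow' : 1 ≤ 2 * K * p := by
    refine le_of_mul_le_mul_right ?_ hA
    linarith
  have hsub : {U | ‖evalEntries F U‖ ^ 2 ≤ ε * A} ⊆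
      {U | ‖evalEntries F U‖ < s * √(A / 2)} := by
    intro U hU
    have hU' : ‖evalEntries F U‖ ^ 2 ≤ ε * A := hU
    refine lt_of_pow_lt_pow_left₀ 2 (by positivity) (hU'.trans_lt ?_)
    rw [mul_pow, Real.sq_sqrt (by positivity)]
    have : 4 * ε ≤ s ^ 2 := hsq ▸ pow_le_pow_left₀ (by positivity) hsL 2
    nlinarith
  have hmono := measureReal_mono (μ := haarUnitary n) hsub
  set P := (haarUnitary n).real {U | ‖evalEntries F U‖ < s * √(A / 2)} with hP
  have hP0 : 0 ≤ P := measureReal_nonneg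
  have hnL : (n : ℝ) * (2 * d) ≤ L := by
    rw [hL]
    push_cast
    nlinarith [(Nat.cast_nonneg n : (0 : ℝ) ≤ n), (Nat.cast_nonneg d : (0 : ℝ) ≤ d)]
  calc _ ≤ P := hmono
    _ ≤ P * (2 * K * p) := le_mul_of_one_le_right hP0 hlow'
    _ = 2 * K * (P * p) := by ring
    _ ≤ 2 * K * (n * ((2 * d) * (8 * η))) := by gcongr
    _ = 16 * K * (n * (2 * d)) * η := by ring
    _ ≤ 16 * K * L * η := by gcongr

end Unitary

/-! ### Passage to the variance -/

/-- The bias–variance decomposition of the second moment about `z`. -/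
lemma integral_norm_sub_sq_eq_complexVar_add {Ω : Type*} [MeasurableSpace Ω] (P : Measure Ω)
    [IsProbabilityMeasure P] {X : Ω → ℂ} (hX : MemLp X 2 P) (z : ℂ) :
    ∫ ω, ‖X ω - z‖ ^ 2 ∂P = complexVar P X + ‖(∫ ω, X ω ∂P) - z‖ ^ 2 := by
  have hX1 : Integrable X P := hX.integrable (by norm_num)
  have hX2 : Integrable (fun ω => ‖X ω‖ ^ 2) P := hX.integrable_norm_pow (by norm_num)
  have h : ∀ x : ℂ, ‖x - z‖ ^ 2 = ‖x‖ ^ 2 - 2 * (x * (starRingEnd ℂ) z).re + ‖z‖ ^ 2 := fun x => by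
    simp only [← Complex.normSq_eq_norm_sq, Complex.normSq_sub]
    ring
  have hre : Integrable (fun ω => (X ω * (starRingEnd ℂ) z).re) P := (hX1.mul_const _).re
  have hsub : Integrable (fun ω => ‖X ω‖ ^ 2 - 2 * (X ω * (starRingEnd ℂ) z).re) P :=
    hX2.sub (hre.const_mul 2)
  simp only [h]
  rw [integral_add hsub (integrable_const _),
    integral_sub hX2 (hre.const_mul 2), integral_const_mul, complexVar]
  have h3 : ∫ ω, (X ω * (starRingEnd ℂ) z).re ∂P = ((∫ ω, X ω ∂P) * (starRingEnd ℂ) z).re := by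
    rw [← integral_mul_const]
    exact integral_re (hX1.mul_const _)
  rw [h3]
  simp
  ring

theorem mainTheorem2 :
    ∃ C C' : ℕ → ℕ → ℝ, (∀ n d : ℕ, 0 < C n d ∧ 0 < C' n d) ∧
      ∀ (n d : ℕ) (F : EntryPolynomial n), F.totalDegree ≤ d →
        complexVar (haarUnitary n) (evalEntries F) ≠ 0 →
        ∀ (ε : ℝ), 0 < ε → ∀ z : ℂ,
          (haarUnitary n).real
            {U | ‖evalEntries F U - z‖ ^ 2
              ≤ ε * complexVar (haarUnitary n) (evalEntries F)} ≤ C' n d * ε ^ C n d := by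
  choose K hK1 hK using exists_sq_norm_evalEntries_le
  refine ⟨fun n d => 1 / (2 * ((2 * d + 1) * (n + 1) : ℕ)),
    fun n d => 32 * K n d * ((2 * d + 1) * (n + 1) : ℕ), fun n d => ⟨by positivity, ?_⟩, ?_⟩
  · have := hK1 n d
    positivity
  intro n d F hF hvar ε hε z
  have hL2 : MemLp (evalEntries F) 2 (haarUnitary n) :=
    (continuous_evalEntries F).memLp_of_hasCompactSupport (HasCompactSupport.of_compactSpace _)
  have hnn : 0 ≤ complexVar (haarUnitary n) (evalEntries F) := by
    have := integral_norm_sub_sq_eq_complexVar_add _ hL2 (∫ U, evalEntries F U ∂haarUnitary n)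
    rw [sub_self, norm_zero, zero_pow two_ne_zero, add_zero] at this
    exact this ▸ integral_nonneg fun U => by positivity
  have hF' : (F - MvPolynomial.C z).totalDegree ≤ d :=
    (MvPolynomial.totalDegree_sub_C_le F z).trans hF
  have hev : ∀ U, evalEntries (F - MvPolynomial.C z) U = evalEntries F U - z := fun U => by
    simp [evalEntries]
  have hle : complexVar (haarUnitary n) (evalEntries F) ≤
      ∫ U, ‖evalEntries (F - MvPolynomial.C z) U‖ ^ 2 ∂haarUnitary n := by
    simp only [hev, integral_norm_sub_sq_eq_complexVar_add _ hL2 z]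
    exact le_add_of_nonneg_right (by positivity)
  refine (measureReal_mono fun U hU => ?_).trans
    (haarUnitary_sq_norm_evalEntries_le (hK1 n d) (hK n d) _ hF'
      ((hnn.lt_of_ne' hvar).trans_le hle) hε)
  rw [Set.mem_ofPred_eq, hev]
  exact (show _ ≤ _ from hU).trans (mul_le_mul_of_nonneg_left hle hε.le)
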